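/- Let $0<\lambda<1$ and $0<a<1$, and write $\bar\lambda=1-\lambda$, $\bar a=1-a$. Consider two relays with infinite buffers in slotted time. At the beginning of each slot a packet arrives with probability $\lambda$; it joins the relay with the shorter queue, and if the queues are equal it joins either relay with probability $1/2$. At the end of the slot (so that a packet that has just arrived counts) each non-empty relay transmits with probability $a$. If exactly one relay transmits, one of its packets leaves the network; if both transmit, a collision occurs and no packet leaves. Arrivals, tie-breaks and transmission attempts are all independent. Let $Q_r(n)$ be the queue length of relay $r$ at the beginning of slot $n$; then $(Q_1(n),Q_2(n))_{n\ge 0}$ is a Markov chain on $\mathbb{Z}_{\ge 0}^2$. In each of the two angles $H=\{(i,j): i>j>0\}$ and $V=\{(i,j): j>i>0\}$ the mean one-step jump vector of the chain does not depend on the state; denote it by $(E_x^H,E_y^H)$ and $(E_x^V,E_y^V)$, respectively. Then $$E_x^H+E_y^H=E_x^V+E_y^V=\lambda-2a\bar a,$$ and the chain is stable (that is, ergodic: irreducible, aperiodic and positive recurrent) if and only if $$E_x^H<0,\qquad E_y^V<0,\qquad \lambda-2a\bar a<0.$$ Equivalently, the chain is stable if and only if the load satisfies $$\rho=\frac{\lambda(\bar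 a^2+a^2)}{2\bar\lambda\,\bar a\,a}<1.$$ -/

import Mathlib

open scoped ENNReal

noncomputable section

namespace MarkovChain

variable {S : Type*}

/-- The `n`-step transition probabilities of the Markov chain with transition function `P`. -/
def nStep (P : S → PMF S) : ℕ → S → PMF S
  | 0, x => PMF.pure x
  | n + 1, x => (P x).bind (nStep P n)

/-- Every state can be reached from every state with positive probability. -/
def IsIrreducible (P : S → PMF S) : Prop :=
  ∀ x y : S, ∃ n : ℕ, 0 < nStep P n x y

/-- For every state `x`, the greatest common divisor of the set of all `n ≥ 1` such that a return
from `x` to `x` in `n` steps has positive probability is `1`. (If the set is empty, then the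
condition fails.) -/
def IsAperiodic (P : S → PMF S) : Prop :=
  ∀ x : S, ∀ d : ℕ, (∀ n : ℕ, 1 ≤ n → 0 < nStep P n x x → d ∣ n) → d = 1

/-- The first-passage probability: `firstPassage P y n x` is the probability that the chain started
at `x` satisfies `X_n = y` and `X_k ≠ y` for all `0 < k < n`, where `n ≥ 1`
(it is `0` for `n = 0`). -/
def firstPassage [DecidableEq S] (P : S → PMF S) (y : S) : ℕ → S → ℝ≥0∞
  | 0, _ => 0
  | 1, x => P x y
  | n + 2, x => ∑' z : S, if z = y then 0 else P x z * firstPassage P y (n + 1) z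

/-- The state `x` is positive recurrent: the chain started at `x` returns to `x` with
probability one, and the mean return time is finite. -/
def IsPositiveRecurrent [DecidableEq S] (P : S → PMF S) (x : S) : Prop :=
  ∑' n : ℕ, firstPassage P x n x = 1 ∧ ∑' n : ℕ, (n : ℝ≥0∞) * firstPassage P x n x < ∞

/-- A Markov chain on a countable state space is ergodic if it is irreducible, aperiodic and
positive recurrent. -/
structure IsErgodic [DecidableEq S] (P : S → PMF S) : Prop where
  irreducible : IsIrreducible P
  aperiodic : IsAperiodic P
  positiveRecurrent : ∀ x : S, IsPositiveRecurrent P x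

end MarkovChain

namespace JSRQ

open unitInterval

/-- A Bernoulli trial which is `true` with probability `p`. -/
def coin (p : I) : PMF Bool :=
  PMF.ofFintype (fun b => bif b then ENNReal.ofReal p else ENNReal.ofReal (1 - p)) (by
    have h0 : (0 : ℝ) ≤ p := p.2.1
    have h1 : (0 : ℝ) ≤ 1 - p := sub_nonneg.2 p.2.2
    simp [← ENNReal.ofReal_add h0 h1])

/-- The fair coin. -/
def fairCoin : PMF Bool :=
  coin ⟨1 / 2, by norm_num, by norm_num⟩

/-- An arriving packet is stored at the relay with the smaller queue; if the two queues are equal,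
it is stored at the first relay when `tie` is `true`, and at the second relay otherwise. -/
def join (tie : Bool) (q : ℕ × ℕ) : ℕ × ℕ :=
  if q.1 < q.2 then (q.1 + 1, q.2)
  else if q.2 < q.1 then (q.1, q.2 + 1)
  else if tie then (q.1 + 1, q.2) else (q.1, q.2 + 1)

/-- The departures at the end of a slot: `t₁`, `t₂` tell which relays attempt a transmission. Only a
non-empty relay transmits. If exactly one relay transmits, then its packet leaves the network; if
both transmit, then there is a collision and no packet leaves. -/
def depart (t₁ t₂ : Bool) (q : ℕ × ℕ) : ℕ × ℕ :=
  if (t₁ ∧ 0 < q.1) ∧ ¬(t₂ ∧ 0 < q.2) then (q.1 - 1, q.2)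
  else if (t₂ ∧ 0 < q.2) ∧ ¬(t₁ ∧ 0 < q.1) then (q.1, q.2 - 1)
  else q

/-- The transition function of the queue length process `(Q₁(n), Q₂(n))` with arrival
probability `lam` per slot and transmission probability `a` of each relay: first a possible arrival
(at the beginning of the slot), then the transmissions (at the end of the slot). The arrival,
the tie-breaking coin and the two transmission attempts are independent. -/
def step (lam a : I) (q : ℕ × ℕ) : PMF (ℕ × ℕ) :=
  (coin lam).bind fun arrival =>
  fairCoin.bind fun tie =>
  (coin a).bind fun t₁ =>
  (coin a).bind fun t₂ =>
  PMF.pure (depart t₁ t₂ (if arrival then join tie q else q))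

/-- The mean jump vector of the chain at the state `q` (only finitely many jumps have positive
probability, so both sums are finite). -/
def meanJump (lam a : I) (q : ℕ × ℕ) : ℝ × ℝ :=
  (∑' r : ℕ × ℕ, (step lam a q r).toReal * ((r.1 : ℝ) - q.1),
   ∑' r : ℕ × ℕ, (step lam a q r).toReal * ((r.2 : ℝ) - q.2))

/-- The angle `H = {(i, j) : i > j > 0}`. -/
def angleH : Set (ℕ × ℕ) := {q | q.1 > q.2 ∧ q.2 > 0}

/-- The angle `V = {(i, j) : j > i > 0}`. -/
def angleV : Set (ℕ × ℕ) := {q | q.2 > q.1 ∧ q.1 > 0}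

/-- The load `ρ = λ (ā² + a²) / (2 λ̄ ā a)`, where a bar denotes the complement to `1`. -/
def load (lam a : ℝ) : ℝ :=
  lam * ((1 - a) ^ 2 + a ^ 2) / (2 * (1 - lam) * (1 - a) * a)

end JSRQ

end

/-! Put p = a(1 - a). When both relays are non-empty, each succeeds with probability p. Hence the
conditions on `EH.1` and `EV.2` read -p < 0 and hold automatically, and both stability criteria
reduce to lam < 2p (`isErgodic_iff`, `load_lt_one_iff`).

If lam < 2p, the drift of i² + j² tends to -∞ as the longer queue grows (`stepMean_sqSum_le`): in
the angles the longer queue loses p per slot on average, and the shorter one gains only lam - p < p.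
Foster's criterion `isPositiveRecurrent_of_drift` applies.

If lam ≥ 2p, the mean change of the total s = i + j can be negative only on an axis. `potential`
adds two corrections to s: -K(1/2)^min rewards leaving an axis, and the convex term (9/10)^s yields
a small gain that pays for the first correction far out on the diagonal. The result is subharmonic
except at finitely many diagonal states, and truncation from below at a high level M removes these.
A function g that is subharmonic everywhere, vanishes at y and has bounded downward jumps is at most
B times the mean hitting time of y. Iterating the killed operator bounds its mean after one step
from y by tails of a convergent series, hence by 0 (`not_isPositiveRecurrent_of_subharmonic`). -/

namespace MarkovChain

/-! ### The killed chain and mean return times -/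

variable {S : Type*} [DecidableEq S]

/-- The transition operator of the chain killed on entering `y`. -/
noncomputable def taboo (P : S → PMF S) (y : S) (f : S → ℝ≥0∞) (x : S) : ℝ≥0∞ :=
  ∑' z, if z = y then 0 else P x z * f z

variable (P : S → PMF S) (y : S)

/-- The probability that the chain started at `x` does not visit `y` at the times `1, …, n`. -/
noncomputable def survival (n : ℕ) : S → ℝ≥0∞ := (taboo P y)^[n] fun _ => 1

variable {P y}

theorem taboo_mono_off {f g : S → ℝ≥0∞} (h : ∀ z, z ≠ y → f z ≤ g z) (x : S) :
    taboo P y f x ≤ taboo P y g x := by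
  refine ENNReal.tsum_le_tsum fun z => ?_
  split_ifs with hz
  · exact le_rfl
  · gcongr
    exact h z hz

theorem taboo_mono : Monotone (taboo P y) := fun _ _ h x => taboo_mono_off (fun z _ => h z) x

theorem taboo_add (f g : S → ℝ≥0∞) (x : S) :
    taboo P y (fun z => f z + g z) x = taboo P y f x + taboo P y g x := by
  unfold taboo
  rw [← ENNReal.tsum_add]
  refine tsum_congr fun z => ?_
  split_ifs <;> ring

theorem taboo_const_mul (c : ℝ≥0∞) (f : S → ℝ≥0∞) (x : S) :
    taboo P y (fun z => c * f z) x = c * taboo P y f x := by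
  unfold taboo
  rw [← ENNReal.tsum_mul_left]
  refine tsum_congr fun z => ?_
  split_ifs <;> ring

theorem taboo_tsum (f : ℕ → S → ℝ≥0∞) (x : S) :
    taboo P y (fun z => ∑' n, f n z) x = ∑' n, taboo P y (f n) x := by
  unfold taboo
  rw [ENNReal.tsum_comm]
  refine tsum_congr fun z => ?_
  split_ifs
  · simp
  · rw [ENNReal.tsum_mul_left]

theorem taboo_le_mean (f : S → ℝ≥0∞) (x : S) : taboo P y f x ≤ ∑' z, P x z * f z := by
  refine ENNReal.tsum_le_tsum fun z => ?_
  split_ifs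
  · exact zero_le
  · exact le_rfl

theorem taboo_eq_mean {f : S → ℝ≥0∞} (hf : f y = 0) (x : S) :
    taboo P y f x = ∑' z, P x z * f z := by
  refine tsum_congr fun z => ?_
  split_ifs with hz
  · simp [hz, hf]
  · rfl

theorem taboo_one_add (x : S) : P x y + taboo P y (fun _ => 1) x = 1 := by
  have h : taboo P y (fun _ => 1) x = ∑' z, if z = y then 0 else P x z := by
    simp [taboo]
  rw [h]
  refine Eq.trans ?_ (P x).tsum_coe
  rw [ENNReal.tsum_eq_add_tsum_ite (f := P x) y]
  congr!

theorem survival_zero (x : S) : survival P y 0 x = 1 := rfl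

theorem survival_succ (n : ℕ) (x : S) :
    survival P y (n + 1) x = taboo P y (survival P y n) x := by
  simp only [survival, Function.iterate_succ_apply']

theorem firstPassage_succ_succ (n : ℕ) (x : S) :
    firstPassage P y (n + 2) x = taboo P y (firstPassage P y (n + 1)) x := rfl

theorem firstPassage_add_survival (n : ℕ) (x : S) :
    firstPassage P y (n + 1) x + survival P y (n + 1) x = survival P y n x := by
  induction n generalizing x with
  | zero => exact taboo_one_add x
  | succ n ih =>
    rw [firstPassage_succ_succ, survival_succ (n + 1), ← taboo_add, survival_succ n]
    congr 1
    exact funext ih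

theorem sum_firstPassage_add_survival (n : ℕ) (x : S) :
    ∑ k ∈ Finset.range n, firstPassage P y (k + 1) x + survival P y n x = 1 := by
  induction n with
  | zero => simp [survival_zero]
  | succ n ih => rw [Finset.sum_range_succ, add_assoc, firstPassage_add_survival, ih]

theorem tsum_firstPassage_succ (x : S) :
    ∑' n, firstPassage P y n x = ∑' n, firstPassage P y (n + 1) x := by
  rw [tsum_eq_zero_add' ENNReal.summable]
  simp [firstPassage]

theorem sum_survival_eq_one_add (n : ℕ) (x : S) :
    ∑ k ∈ Finset.range (n + 1), survival P y k x
      = 1 + taboo P y (fun z => ∑ k ∈ Finset.range n, survival P y k z) x := by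
  rw [Finset.sum_range_succ', add_comm, survival_zero]
  congr 1
  induction n with
  | zero => simp [taboo]
  | succ n ih =>
    simp only [Finset.sum_range_succ _ n, taboo_add]
    rw [ih, survival_succ]

/-- Interchanging the order of summation in the mean of an `ℕ`-valued variable. -/
theorem tsum_natCast_mul_eq (f : ℕ → ℝ≥0∞) :
    ∑' n : ℕ, (n : ℝ≥0∞) * f n = ∑' k : ℕ, ∑' n : ℕ, f (n + k + 1) := by
  have h : ∀ n : ℕ, (n : ℝ≥0∞) * f n = ∑' k : ℕ, if k < n then f n else 0 := by
    intro n
    rw [tsum_eq_sum (s := Finset.range n) (by intro b hb; simp_all)]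
    rw [Finset.sum_congr rfl (g := fun _ => f n) (by intro b hb; simp_all)]
    simp
  simp_rw [h]
  rw [ENNReal.tsum_comm]
  refine tsum_congr fun k => ?_
  rw [← Summable.sum_add_tsum_nat_add' (k := k + 1) ENNReal.summable]
  rw [Finset.sum_eq_zero (by
    intro i hi
    have := Finset.mem_range.1 hi
    rw [if_neg (by omega)]), zero_add]
  refine tsum_congr fun n => ?_
  rw [if_pos (by omega), add_assoc]

theorem survival_ne_top (n : ℕ) (x : S) : survival P y n x ≠ ∞ :=
  ne_top_of_le_ne_top ENNReal.one_ne_top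
    ((sum_firstPassage_add_survival (P := P) (y := y) n x).le.trans' le_add_self)

theorem tsum_firstPassage_add_eq {x : S} (hx : ∑' n, firstPassage P y n x = 1) (k : ℕ) :
    ∑' n, firstPassage P y (n + k + 1) x = survival P y k x := by
  rw [tsum_firstPassage_succ, ← Summable.sum_add_tsum_nat_add' (k := k) ENNReal.summable,
    ← sum_firstPassage_add_survival (P := P) (y := y) k x] at hx
  refine (ENNReal.add_right_inj ?_).1 hx
  refine ne_top_of_le_ne_top ENNReal.one_ne_top
    ((sum_firstPassage_add_survival (P := P) (y := y) k x).le.trans' le_self_add)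

/-- Passage by time n and survival to time n have total mass 1, and summable survival probabilities
tend to 0. -/
theorem tsum_firstPassage_eq_one {x : S} (hx : ∑' n, survival P y n x ≠ ∞) :
    ∑' n, firstPassage P y n x = 1 := by
  rw [tsum_firstPassage_succ]
  have h1 := ENNReal.tendsto_nat_tsum fun n => firstPassage P y (n + 1) x
  have h2 := (h1.add (ENNReal.tendsto_atTop_zero_of_tsum_ne_top hx))
  simp only [sum_firstPassage_add_survival, add_zero] at h2
  exact tendsto_nhds_unique h2 tendsto_const_nhds

theorem tsum_natCast_mul_firstPassage {x : S} (hx : ∑' n, firstPassage P y n x = 1) :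
    ∑' n : ℕ, (n : ℝ≥0∞) * firstPassage P y n x = ∑' n, survival P y n x := by
  rw [tsum_natCast_mul_eq]
  exact tsum_congr fun k => tsum_firstPassage_add_eq hx k

/-- A state is positive recurrent iff the tail probabilities of its return time are summable. -/
theorem isPositiveRecurrent_iff :
    IsPositiveRecurrent P y ↔ ∑' n, survival P y n y ≠ ∞ := by
  constructor
  · rintro ⟨h1, h2⟩
    rw [← tsum_natCast_mul_firstPassage h1]
    exact h2.ne
  · intro h
    have h1 := tsum_firstPassage_eq_one h
    exact ⟨h1, by rw [tsum_natCast_mul_firstPassage h1]; exact h.lt_top⟩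

/-! ### Foster's criterion -/

theorem nStep_succ {S : Type*} {P : S → PMF S} (n : ℕ) (x z : S) :
    nStep P (n + 1) x z = ∑' w, P x w * nStep P n w z := rfl

/-- Being at `y` at time n and avoiding `y` up to time n are disjoint events. The case `x = y` is
separate because survival ignores time 0. -/
theorem nStep_add_survival_le (n : ℕ) (x : S) :
    nStep P n x y + (if x = y then 0 else survival P y n x) ≤ 1 := by
  induction n generalizing x with
  | zero =>
    split_ifs with h
    · simpa using PMF.coe_le_one _ _
    · simp [nStep, PMF.pure_apply, Ne.symm h, survival_zero]
  | succ n ih =>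
    split_ifs with h
    · simpa using PMF.coe_le_one _ _
    · rw [nStep_succ, survival_succ, taboo, ← ENNReal.tsum_add, ← (P x).tsum_coe]
      refine ENNReal.tsum_le_tsum fun z => ?_
      calc _ = P x z * (nStep P n z y + (if z = y then 0 else survival P y n z)) := by
            split_ifs <;> ring
        _ ≤ P x z * 1 := by gcongr; exact ih z
        _ = _ := mul_one _

theorem survival_antitone (x : S) : Antitone fun n => survival P y n x :=
  antitone_nat_of_succ_le fun n => (firstPassage_add_survival n x).le.trans' le_add_self

theorem exists_survival_lt_one (hP : IsIrreducible P) {A : Set S} (hA : A.Finite) :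
    ∃ N, ∀ x ∈ A, x ≠ y → survival P y N x < 1 := by
  choose n hn using fun x => hP x y
  refine ⟨hA.toFinset.sup n, fun x hx hxy => ?_⟩
  have h1 : n x ≤ hA.toFinset.sup n := Finset.le_sup (by simpa using hx)
  refine (survival_antitone x h1).trans_lt ?_
  have h2 := nStep_add_survival_le (P := P) (y := y) (n x) x
  rw [if_neg hxy] at h2
  refine lt_of_lt_of_le ?_ h2
  rw [add_comm]
  exact ENNReal.lt_add_right (survival_ne_top _ _) (hn x).ne'

/-- Such a `V` dominates the mean hitting time of `y`, by induction on the truncation of the time.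
-/
theorem isPositiveRecurrent_of_taboo_le {V : S → ℝ≥0∞}
    (hV : ∀ x, x ≠ y → taboo P y V x + 1 ≤ V x) (hy : taboo P y V y ≠ ∞) :
    IsPositiveRecurrent P y := by
  have key : ∀ n x, x ≠ y → ∑ k ∈ Finset.range n, survival P y k x ≤ V x := by
    intro n
    induction n with
    | zero => simp
    | succ n ih =>
      intro x hx
      rw [sum_survival_eq_one_add, add_comm]
      refine le_trans ?_ (hV x hx)
      gcongr
      exact taboo_mono_off ih x
  rw [isPositiveRecurrent_iff]
  refine ne_top_of_le_ne_top (ENNReal.add_ne_top.2 ⟨ENNReal.one_ne_top, hy⟩) ?_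
  rw [ENNReal.tsum_eq_iSup_nat]
  refine iSup_le fun n => ?_
  calc _ ≤ ∑ k ∈ Finset.range (n + 1), survival P y k y :=
        Finset.sum_le_sum_of_subset (Finset.range_mono n.le_succ)
    _ ≤ _ := by
        rw [sum_survival_eq_one_add]
        gcongr
        exact taboo_mono_off (key n) y

/-- **Foster's criterion**: an irreducible chain with a Lyapunov function whose drift is at most
`-1` outside a finite set is positive recurrent. -/
theorem isPositiveRecurrent_of_drift (hP : IsIrreducible P) {V : S → ℝ≥0∞}
    {A : Set S} (hA : A.Finite) (hPV : ∀ x, ∑' z, P x z * V z ≠ ∞)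
    (hdrift : ∀ x, x ∉ A → ∑' z, P x z * V z + 1 ≤ V x) (y : S) :
    IsPositiveRecurrent P y := by
  obtain ⟨N, hN⟩ := exists_survival_lt_one (y := y) hP hA
  -- The size `K` must have for the correction `K * F` below to absorb the uncontrolled drift of `V`
  -- at `x ∈ A`.
  let b : S → ℝ≥0∞ := fun x => (∑' z, P x z * V z + 1) / (1 - survival P y N x)
  have hb : ∀ x ∈ A, x ≠ y → b x ≠ ∞ := fun x hx hxy =>
    ENNReal.div_ne_top (ENNReal.add_ne_top.2 ⟨hPV x, ENNReal.one_ne_top⟩)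
      (tsub_pos_of_lt (hN x hx hxy)).ne'
  obtain ⟨K, hK, hKb⟩ : ∃ K : ℝ≥0∞, K ≠ ∞ ∧ ∀ x ∈ A, x ≠ y → b x ≤ K := by
    refine ⟨∑ x ∈ hA.toFinset, if x = y then 0 else b x, ?_, fun x hx hxy => ?_⟩
    · refine ENNReal.sum_ne_top.2 fun x hx => ?_
      split_ifs with h
      · simp
      · exact hb x (by simpa using hx) h
    · have := Finset.single_le_sum (f := fun x => if x = y then 0 else b x)
        (fun i _ => zero_le) (hA.mem_toFinset.2 hx)
      simpa [hxy] using this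
  -- The mean hitting time truncated at `N`. Its killed drift is `survival P y N x - 1`: never
  -- positive, and negative on `A` away from `y`.
  let F : S → ℝ≥0∞ := fun z => ∑ k ∈ Finset.range N, survival P y k z
  have hF : ∀ x, F x ≠ ∞ := fun x => ENNReal.sum_ne_top.2 fun k _ => survival_ne_top k x
  have hQF : ∀ x, taboo P y F x + 1 = F x + survival P y N x := by
    intro x
    rw [add_comm, ← sum_survival_eq_one_add, Finset.sum_range_succ]
  refine isPositiveRecurrent_of_taboo_le (V := fun x => V x + K * F x) (fun x hx => ?_) ?_
  · rw [taboo_add, taboo_const_mul]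
    have h1 : taboo P y V x + 1 + K * survival P y N x ≤ V x + K := by
      by_cases hxA : x ∈ A
      · have hlt := hN x hxA hx
        have h2 : taboo P y V x + 1 ≤ K * (1 - survival P y N x) := by
          have := hKb x hxA hx
          rw [ENNReal.div_le_iff (tsub_pos_of_lt hlt).ne'
            (ne_top_of_le_ne_top ENNReal.one_ne_top tsub_le_self)] at this
          refine le_trans ?_ this
          gcongr
          exact taboo_le_mean V x
        calc _ ≤ K * (1 - survival P y N x) + K * survival P y N x := by gcongr
          _ = K := by rw [← mul_add, tsub_add_cancel_of_le hlt.le, mul_one]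
          _ ≤ _ := le_add_self
      · have h2 : survival P y N x ≤ 1 := survival_antitone x (Nat.zero_le N)
        calc _ ≤ V x + K * 1 := by
              gcongr
              refine le_trans ?_ (hdrift x hxA)
              gcongr
              exact taboo_le_mean V x
          _ = _ := by rw [mul_one]
    refine (ENNReal.add_le_add_iff_right hK).1 ?_
    calc taboo P y V x + K * taboo P y F x + 1 + K
        = taboo P y V x + 1 + K * (taboo P y F x + 1) := by ring
      _ = (taboo P y V x + 1 + K * survival P y N x) + K * F x := by rw [hQF]; ring
      _ ≤ V x + K + K * F x := by gcongr
      _ = _ := by ring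
  · rw [taboo_add, taboo_const_mul]
    refine ENNReal.add_ne_top.2 ⟨ne_top_of_le_ne_top (hPV y) (taboo_le_mean V y),
      ENNReal.mul_ne_top hK ?_⟩
    refine ne_top_of_le_ne_top (b := F y + survival P y N y)
      (ENNReal.add_ne_top.2 ⟨hF y, survival_ne_top _ _⟩) ?_
    rw [← hQF]
    exact le_self_add

/-! ### A criterion against positive recurrence -/

theorem le_of_firstPassage_ne_zero {g : S → ℝ≥0∞} {B : ℝ≥0∞} (hy : g y = 0)
    (hB : ∀ x z, P x z ≠ 0 → g x ≤ g z + B) (n : ℕ) (x : S)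
    (h : firstPassage P y n x ≠ 0) : g x ≤ n * B := by
  induction n generalizing x with
  | zero => exact absurd rfl h
  | succ n ih =>
    cases n with
    | zero => simpa [hy] using hB x y h
    | succ n =>
      rw [firstPassage_succ_succ, taboo, Ne, ENNReal.tsum_eq_zero, not_forall] at h
      obtain ⟨z, hz⟩ := h
      split_ifs at hz with hzy
      · exact absurd rfl hz
      · have h1 := ih z (right_ne_zero_of_mul hz)
        calc g x ≤ g z + B := hB x z (left_ne_zero_of_mul hz)
          _ ≤ ((n + 1 : ℕ) : ℝ≥0∞) * B + B := by gcongr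
          _ = _ := by push_cast; ring

/-- A path reaching `y` in n steps forces `g x ≤ n * B`; average over the passage time. `B ≠ 0`
matters because `0 * ∞ = 0`. -/
theorem le_mul_tsum_survival {g : S → ℝ≥0∞} {B : ℝ≥0∞} (hB₀ : B ≠ 0) (hy : g y = 0)
    (hB : ∀ x z, P x z ≠ 0 → g x ≤ g z + B) (x : S) :
    g x ≤ B * ∑' n, survival P y n x := by
  by_cases hx : ∑' n, survival P y n x = ∞
  · rw [hx, ENNReal.mul_top hB₀]
    exact le_top
  · have h1 := tsum_firstPassage_eq_one hx
    rw [← tsum_natCast_mul_firstPassage h1, ← ENNReal.tsum_mul_left]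
    calc g x = g x * ∑' n, firstPassage P y n x := by rw [h1, mul_one]
      _ = ∑' n, g x * firstPassage P y n x := ENNReal.tsum_mul_left.symm
      _ ≤ _ := by
        refine ENNReal.tsum_le_tsum fun n => ?_
        by_cases h : firstPassage P y n x = 0
        · simp [h]
        · calc g x * firstPassage P y n x ≤ (n * B) * firstPassage P y n x := by
                gcongr
                exact le_of_firstPassage_ne_zero hy hB n x h
            _ = _ := by ring

theorem iterate_taboo_const_mul_tsum (B : ℝ≥0∞) (n : ℕ) (x : S) :
    (taboo P y)^[n] (fun z => B * ∑' k, survival P y k z) x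
      = B * ∑' k, survival P y (k + n) x := by
  induction n generalizing x with
  | zero => rfl
  | succ n ih =>
    rw [Function.iterate_succ_apply', funext ih, taboo_const_mul, taboo_tsum]
    simp_rw [← survival_succ]
    rfl

/-- A chain with a nonnegative subharmonic function whose downward jumps are bounded is not positive
recurrent at a zero of this function from which the function can become positive. -/
theorem not_isPositiveRecurrent_of_subharmonic {g : S → ℝ≥0∞} {B : ℝ≥0∞} (hBtop : B ≠ ∞)
    (hy : g y = 0) (hB : ∀ x z, P x z ≠ 0 → g x ≤ g z + B)
    (hg : ∀ x, g x ≤ ∑' z, P x z * g z) (hpos : ∃ z, P y z ≠ 0 ∧ g z ≠ 0) :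
    ¬ IsPositiveRecurrent P y := by
  intro hrec
  rw [isPositiveRecurrent_iff] at hrec
  wlog hB₀ : B ≠ 0 generalizing B
  · exact this ENNReal.one_ne_top (fun x z h => (hB x z h).trans (by
      rw [not_not.1 hB₀, add_zero]; exact le_self_add)) one_ne_zero
  -- Killing at `y` costs nothing since `g y = 0`, so the iterates of the killed operator on `g`
  -- increase.
  have h1 : g ≤ taboo P y g := fun x => by rw [taboo_eq_mean hy]; exact hg x
  have h2 : ∀ n, taboo P y g y ≤ (taboo P y)^[n + 1] g y := fun n => by
    have h3 : Monotone fun n => (taboo P y)^[n] g :=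
      Monotone.monotone_iterate_of_le_map taboo_mono h1
    exact h3 (show 1 ≤ n + 1 by omega) y
  have h3 : ∀ n, (taboo P y)^[n] g y ≤ B * ∑' k, survival P y (k + n) y := fun n => by
    rw [← iterate_taboo_const_mul_tsum]
    exact (taboo_mono (P := P) (y := y)).iterate n (le_mul_tsum_survival hB₀ hy hB) y
  have h4 : Filter.Tendsto (fun n => B * ∑' k, survival P y (k + n) y) Filter.atTop
      (nhds (B * 0)) :=
    ENNReal.Tendsto.const_mul (ENNReal.tendsto_sum_nat_add _ hrec) (Or.inr hBtop)
  rw [mul_zero] at h4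
  have h5 : taboo P y g y ≤ 0 := by
    refine ge_of_tendsto (h4.comp (Filter.tendsto_add_atTop_nat 1)) (Filter.Eventually.of_forall ?_)
    exact fun n => (h2 n).trans (h3 (n + 1))
  obtain ⟨z, hz, hgz⟩ := hpos
  rw [taboo_eq_mean hy, nonpos_iff_eq_zero, ENNReal.tsum_eq_zero] at h5
  exact mul_ne_zero hz hgz (h5 z)

end MarkovChain

/-! ### Expectations over one slot -/

namespace JSRQ

open unitInterval MarkovChain

/-- The real function `φ` has mean `m` under the distribution `p`. -/
def HasMean {S : Type*} (p : PMF S) (φ : S → ℝ) (m : ℝ) : Prop :=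
  HasSum (fun r => (p r).toReal * φ r) m

theorem HasMean.pure {S : Type*} (φ : S → ℝ) (s : S) : HasMean (PMF.pure s) φ (φ s) := by
  have := hasSum_single (f := fun r => (PMF.pure s r).toReal * φ r) s
    (fun r hr => by simp [PMF.pure_apply, hr])
  simpa [HasMean, PMF.pure_apply] using this

theorem coin_true (p : I) : coin p true = ENNReal.ofReal p := rfl

theorem coin_false (p : I) : coin p false = ENNReal.ofReal (1 - p) := rfl

theorem coin_bind_apply {S : Type*} (p : I) (k : Bool → PMF S) (r : S) :
    (coin p).bind k r = ENNReal.ofReal p * k true r + ENNReal.ofReal (1 - p) * k false r := by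
  rw [PMF.bind_apply, tsum_bool, coin_true, coin_false, add_comm]

theorem HasMean.coin_bind {S : Type*} {p : I} {k : Bool → PMF S} {φ : S → ℝ} {m : Bool → ℝ}
    (h : ∀ b, HasMean (k b) φ (m b)) :
    HasMean ((coin p).bind k) φ (p * m true + (1 - p) * m false) := by
  have h1 := (HasSum.mul_left (p : ℝ) (h true)).add (HasSum.mul_left (1 - p : ℝ) (h false))
  have h2 : ∀ r, ((coin p).bind k r).toReal * φ r
      = p * ((k true r).toReal * φ r) + (1 - p) * ((k false r).toReal * φ r) := fun r => by
    rw [coin_bind_apply,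
      ENNReal.toReal_add (ENNReal.mul_ne_top ENNReal.ofReal_ne_top (PMF.apply_ne_top _ _))
        (ENNReal.mul_ne_top ENNReal.ofReal_ne_top (PMF.apply_ne_top _ _)), ENNReal.toReal_mul,
      ENNReal.toReal_mul, ENNReal.toReal_ofReal p.2.1, ENNReal.toReal_ofReal (sub_nonneg.2 p.2.2)]
    ring
  simpa only [HasMean, h2] using h1

/-- The mean of `φ` after the transmission phase. -/
noncomputable def departMean (a : ℝ) (φ : ℕ × ℕ → ℝ) (q : ℕ × ℕ) : ℝ :=
  a * (a * φ (depart true true q) + (1 - a) * φ (depart true false q)) +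
    (1 - a) * (a * φ (depart false true q) + (1 - a) * φ (depart false false q))

/-- The mean of `φ` after one slot. -/
noncomputable def stepMean (lam a : ℝ) (φ : ℕ × ℕ → ℝ) (q : ℕ × ℕ) : ℝ :=
  lam * ((departMean a φ (join true q) + departMean a φ (join false q)) / 2) +
    (1 - lam) * departMean a φ q

theorem hasMean_step (lam a : I) (φ : ℕ × ℕ → ℝ) (q : ℕ × ℕ) :
    HasMean (step lam a q) φ (stepMean lam a φ q) := by
  have h : HasMean (step lam a q) φ _ := HasMean.coin_bind (p := lam) fun arrival =>
    HasMean.coin_bind (p := ⟨1 / 2, by norm_num, by norm_num⟩) fun tie =>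
    HasMean.coin_bind (p := a) fun t₁ =>
    HasMean.coin_bind (p := a) fun t₂ =>
    HasMean.pure φ (depart t₁ t₂ (if arrival then join tie q else q))
  refine Eq.subst (motive := HasMean _ _) ?_ h
  simp only [stepMean, departMean, if_true, Bool.false_eq_true, if_false]
  ring

/-- Carries the explicit real means over to the extended nonnegative sums of the two recurrence
criteria. -/
theorem tsum_step_mul_ofReal (lam a : I) {φ : ℕ × ℕ → ℝ} (hφ : ∀ q, 0 ≤ φ q) (q : ℕ × ℕ) :
    ∑' r, step lam a q r * ENNReal.ofReal (φ r) = ENNReal.ofReal (stepMean lam a φ q) := by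
  have h := hasMean_step lam a φ q
  rw [← HasSum.tsum_eq h, ENNReal.ofReal_tsum_of_nonneg
    (fun r => mul_nonneg ENNReal.toReal_nonneg (hφ r)) h.summable]
  refine tsum_congr fun r => ?_
  rw [ENNReal.ofReal_mul ENNReal.toReal_nonneg, ENNReal.ofReal_toReal (PMF.apply_ne_top _ _)]

theorem meanJump_eq (lam a : I) (q : ℕ × ℕ) :
    meanJump lam a q = (stepMean lam a (fun r => (r.1 : ℝ) - q.1) q,
      stepMean lam a (fun r => (r.2 : ℝ) - q.2) q) :=
  Prod.ext (hasMean_step lam a _ q).tsum_eq (hasMean_step lam a _ q).tsum_eq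

theorem depart_swap (t₁ t₂ : Bool) (q : ℕ × ℕ) :
    depart t₁ t₂ q.swap = (depart t₂ t₁ q).swap := by
  obtain ⟨i, j⟩ := q
  simp only [depart, Prod.fst_swap, Prod.snd_swap]
  split_ifs <;> simp_all

theorem join_swap (tie : Bool) (q : ℕ × ℕ) : join tie q.swap = (join (!tie) q).swap := by
  obtain ⟨i, j⟩ := q
  simp only [join, Prod.fst_swap, Prod.snd_swap]
  split_ifs <;> simp_all
  omega

theorem departMean_swap (a : ℝ) {φ : ℕ × ℕ → ℝ} (hφ : ∀ q, φ q.swap = φ q) (q : ℕ × ℕ) :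
    departMean a φ q.swap = departMean a φ q := by
  simp only [departMean, depart_swap, hφ]
  ring

theorem stepMean_swap (lam a : ℝ) {φ : ℕ × ℕ → ℝ} (hφ : ∀ q, φ q.swap = φ q) (q : ℕ × ℕ) :
    stepMean lam a φ q.swap = stepMean lam a φ q := by
  simp only [stepMean, join_swap, departMean_swap a hφ, Bool.not_true, Bool.not_false]
  ring

theorem stepMean_mono {lam a : I} {φ ψ : ℕ × ℕ → ℝ} (h : ∀ q, φ q ≤ ψ q) (q : ℕ × ℕ) :
    stepMean lam a φ q ≤ stepMean lam a ψ q :=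
  hasSum_le (fun r => mul_le_mul_of_nonneg_left (h r) ENNReal.toReal_nonneg)
    (hasMean_step lam a φ q) (hasMean_step lam a ψ q)

theorem mem_support_step {lam a : I} {q r : ℕ × ℕ} (h : step lam a q r ≠ 0) :
    ∃ t₁ t₂ : Bool, r = depart t₁ t₂ q ∨ ∃ tie, r = depart t₁ t₂ (join tie q) := by
  have := (PMF.mem_support_iff _ _).2 h
  simp only [step, PMF.support_bind, PMF.support_pure, Set.mem_iUnion, Set.mem_singleton_iff] at this
  obtain ⟨arrival, -, tie, -, t₁, -, t₂, -, rfl⟩ := this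
  refine ⟨t₁, t₂, ?_⟩
  cases arrival
  · exact Or.inl rfl
  · exact Or.inr ⟨tie, rfl⟩

theorem coin_ne_zero {p : I} (h₀ : 0 < p) (h₁ : p < 1) (b : Bool) : coin p b ≠ 0 := by
  have h0 : (0 : ℝ) < p := h₀
  have h1 : (p : ℝ) < 1 := h₁
  cases b
  · simpa [coin_false] using h1
  · simpa [coin_true] using h0

section

variable {lam a : I} (hlam₀ : 0 < lam) (hlam₁ : lam < 1) (ha₀ : 0 < a) (ha₁ : a < 1)

include hlam₀ hlam₁ ha₀ ha₁

theorem step_ne_zero (arrival tie t₁ t₂ : Bool) (q : ℕ × ℕ) :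
    step lam a q (depart t₁ t₂ (if arrival then join tie q else q)) ≠ 0 := by
  rw [← PMF.mem_support_iff]
  simp only [step, PMF.support_bind, PMF.support_pure, Set.mem_iUnion]
  exact ⟨arrival, coin_ne_zero hlam₀ hlam₁ _, tie, coin_ne_zero (by
    rw [← Subtype.coe_lt_coe]; norm_num) (by rw [← Subtype.coe_lt_coe]; norm_num) _,
    t₁, coin_ne_zero ha₀ ha₁ _, t₂, coin_ne_zero ha₀ ha₁ _, rfl⟩

end

end JSRQ

/-! ### Irreducibility and aperiodicity -/

namespace MarkovChain

/-- Some path of positive probability leads from `x` to `y`. -/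
def Reaches {S : Type*} (P : S → PMF S) : S → S → Prop :=
  Relation.ReflTransGen fun x y => P x y ≠ 0

theorem Reaches.exists_nStep_pos {S : Type*} {P : S → PMF S} {x y : S} (h : Reaches P x y) :
    ∃ n, 0 < nStep P n x y := by
  induction h using Relation.ReflTransGen.head_induction_on with
  | refl => exact ⟨0, by simp [nStep]⟩
  | head hxz _ ih =>
    obtain ⟨n, hn⟩ := ih
    refine ⟨n + 1, pos_iff_ne_zero.2 ?_⟩
    rw [nStep_succ, Ne, ENNReal.tsum_eq_zero, not_forall]
    exact ⟨_, mul_ne_zero hxz hn.ne'⟩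

theorem isAperiodic_of_self_ne_zero {S : Type*} {P : S → PMF S} (h : ∀ x, P x x ≠ 0) :
    IsAperiodic P := by
  refine fun x d hd => Nat.dvd_one.1 (hd 1 le_rfl ?_)
  simpa [nStep, pos_iff_ne_zero, PMF.bind_pure] using h x

end MarkovChain

namespace JSRQ

open unitInterval MarkovChain

section

variable {lam a : I} (hlam₀ : 0 < lam) (hlam₁ : lam < 1) (ha₀ : 0 < a) (ha₁ : a < 1)

include hlam₀ hlam₁ ha₀ ha₁

theorem isAperiodic_step : IsAperiodic (step lam a) :=
  isAperiodic_of_self_ne_zero fun x => by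
    simpa [depart] using step_ne_zero hlam₀ hlam₁ ha₀ ha₁ false false false false x

theorem reaches_pred_left (i j : ℕ) : Reaches (step lam a) (i + 1, j) (i, j) :=
  .single (by simpa [depart] using step_ne_zero hlam₀ hlam₁ ha₀ ha₁ false false true false (i + 1, j))

theorem reaches_pred_right (i j : ℕ) : Reaches (step lam a) (i, j + 1) (i, j) :=
  .single (by simpa [depart] using step_ne_zero hlam₀ hlam₁ ha₀ ha₁ false false false true (i, j + 1))

theorem reaches_of_le {i j k l : ℕ} (hi : k ≤ i) (hj : l ≤ j) :
    Reaches (step lam a) (i, j) (k, l) := by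
  refine Relation.ReflTransGen.trans (b := (k, j)) ?_ ?_
  · induction i, hi using Nat.le_induction with
    | base => exact .refl
    | succ i _ ih => exact (reaches_pred_left hlam₀ hlam₁ ha₀ ha₁ i j).trans ih
  · induction j, hj using Nat.le_induction with
    | base => exact .refl
    | succ j _ ih => exact (reaches_pred_right hlam₀ hlam₁ ha₀ ha₁ k j).trans ih

theorem reaches_diagonal (k : ℕ) : Reaches (step lam a) (0, 0) (k, k) := by
  induction k with
  | zero => exact .refl
  | succ k ih =>
    -- Two arrivals without transmissions; the second is forced to the shorter queue.
    refine (ih.tail (b := (k, k)) (c := (k + 1, k)) ?_).tail ?_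
    · simpa [depart, join] using step_ne_zero hlam₀ hlam₁ ha₀ ha₁ true true false false (k, k)
    · simpa [depart, join] using step_ne_zero hlam₀ hlam₁ ha₀ ha₁ true true false false (k + 1, k)

theorem isIrreducible_step : IsIrreducible (step lam a) := by
  rintro ⟨i, j⟩ ⟨k, l⟩
  refine Reaches.exists_nStep_pos ?_
  exact ((reaches_of_le hlam₀ hlam₁ ha₀ ha₁ i.zero_le j.zero_le).trans
    (reaches_diagonal hlam₀ hlam₁ ha₀ ha₁ (max k l))).trans
    (reaches_of_le hlam₀ hlam₁ ha₀ ha₁ (le_max_left _ _) (le_max_right _ _))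

end

/-! ### Explicit one-slot means and mean jumps -/

theorem departMean_succ_succ (a : ℝ) (φ : ℕ × ℕ → ℝ) (i j : ℕ) :
    departMean a φ (i + 1, j + 1) = (1 - 2 * (a * (1 - a))) * φ (i + 1, j + 1) +
      a * (1 - a) * φ (i, j + 1) + a * (1 - a) * φ (i + 1, j) := by
  simp [departMean, depart]
  ring

theorem departMean_succ_zero (a : ℝ) (φ : ℕ × ℕ → ℝ) (i : ℕ) :
    departMean a φ (i + 1, 0) = (1 - a) * φ (i + 1, 0) + a * φ (i, 0) := by
  simp [departMean, depart]
  ring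

theorem departMean_zero_zero (a : ℝ) (φ : ℕ × ℕ → ℝ) : departMean a φ (0, 0) = φ (0, 0) := by
  simp [departMean, depart]
  ring

theorem stepMean_of_lt (lam a : ℝ) (φ : ℕ × ℕ → ℝ) {i j : ℕ} (h : j < i) :
    stepMean lam a φ (i, j) = lam * departMean a φ (i, j + 1) + (1 - lam) * departMean a φ (i, j) := by
  simp [stepMean, join, h, h.not_gt]

theorem stepMean_of_gt (lam a : ℝ) (φ : ℕ × ℕ → ℝ) {i j : ℕ} (h : i < j) :
    stepMean lam a φ (i, j) = lam * departMean a φ (i + 1, j) + (1 - lam) * departMean a φ (i, j) := by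
  simp [stepMean, join, h]

/-- The two outcomes of the tie-break are mirror images, so a symmetric function does not see the
coin. -/
theorem stepMean_diagonal (lam a : ℝ) {φ : ℕ × ℕ → ℝ} (hφ : ∀ q, φ q.swap = φ q) (k : ℕ) :
    stepMean lam a φ (k, k)
      = lam * departMean a φ (k + 1, k) + (1 - lam) * departMean a φ (k, k) := by
  have h := departMean_swap a hφ (k + 1, k)
  simp only [Prod.swap_prod_mk] at h
  simp [stepMean, join, h]

theorem stepMean_sub_const (lam a : ℝ) (φ : ℕ × ℕ → ℝ) (M : ℝ) (q : ℕ × ℕ) :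
    stepMean lam a (fun r => φ r - M) q = stepMean lam a φ q - M := by
  simp only [stepMean, departMean]
  ring

/-- It suffices to compare a symmetric function with its mean below the diagonal. -/
theorem symmetric_induction {C : ℕ × ℕ → Prop} (hC : ∀ q, C q → C q.swap)
    (origin : C (0, 0)) (diagonal : ∀ k, C (k + 1, k + 1)) (axis : ∀ i, C (i + 1, 0))
    (angle : ∀ i j, j < i → C (i + 1, j + 1)) (q : ℕ × ℕ) : C q := by
  have h : ∀ i j, j ≤ i → C (i, j)
    | 0, 0, _ => origin
    | i + 1, 0, _ => axis i
    | i + 1, j + 1, hij => by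
      rcases (Nat.le_of_succ_le_succ hij).eq_or_lt with rfl | h
      · exact diagonal j
      · exact angle i j h
  obtain ⟨i, j⟩ := q
  rcases le_total j i with hij | hij
  · exact h i j hij
  · exact hC _ (h j i hij)

theorem meanJump_angleH (lam a : I) {q : ℕ × ℕ} (hq : q ∈ angleH) :
    meanJump lam a q = (-(a * (1 - a) : ℝ), (lam - a * (1 - a) : ℝ)) := by
  obtain ⟨i, j⟩ := q
  obtain ⟨h1, h2⟩ : j < i ∧ 0 < j := hq
  obtain ⟨j, rfl⟩ := Nat.exists_eq_add_of_lt h2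
  obtain ⟨i, rfl⟩ := Nat.exists_eq_add_of_lt (h2.trans h1)
  simp only [zero_add] at h1 ⊢
  rw [meanJump_eq, stepMean_of_lt _ _ _ h1, stepMean_of_lt _ _ _ h1]
  simp only [departMean_succ_succ]
  ext <;> push_cast <;> ring

theorem meanJump_angleV (lam a : I) {q : ℕ × ℕ} (hq : q ∈ angleV) :
    meanJump lam a q = ((lam - a * (1 - a) : ℝ), -(a * (1 - a) : ℝ)) := by
  obtain ⟨i, j⟩ := q
  obtain ⟨h1, h2⟩ : i < j ∧ 0 < i := hq
  obtain ⟨i, rfl⟩ := Nat.exists_eq_add_of_lt h2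
  obtain ⟨j, rfl⟩ := Nat.exists_eq_add_of_lt (h2.trans h1)
  simp only [zero_add] at h1 ⊢
  rw [meanJump_eq, stepMean_of_gt _ _ _ h1, stepMean_of_gt _ _ _ h1]
  simp only [departMean_succ_succ]
  ext <;> push_cast <;> ring

/-! ### Stability below the threshold -/

/-- The quadratic Lyapunov function. -/
def sqSum (q : ℕ × ℕ) : ℝ := (q.1 : ℝ) ^ 2 + (q.2 : ℝ) ^ 2

theorem sqSum_swap (q : ℕ × ℕ) : sqSum q.swap = sqSum q := add_comm _ _

theorem stepMean_sqSum_le {lam a c : ℝ} (hlam₀ : 0 < lam) (hlam₁ : lam < 1) (ha₀ : 0 < a)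
    (ha₁ : a < 1) (hc₁ : c ≤ a * (1 - a)) (hc₂ : c ≤ 2 * (a * (1 - a)) - lam)
    (q : ℕ × ℕ) : stepMean lam a sqSum q ≤ sqSum q + 2 - 2 * c * (max q.1 q.2 : ℕ) := by
  have hp₀ : 0 < a * (1 - a) := mul_pos ha₀ (sub_pos.2 ha₁)
  have hp₁ : a * (1 - a) ≤ 1 / 4 := by nlinarith [sq_nonneg (2 * a - 1)]
  -- On an axis without an arrival, the longer queue shrinks at rate a, which is no worse than p.
  have hpa : a * (1 - a) ≤ a := by nlinarith
  refine symmetric_induction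
    (C := fun q => stepMean lam a sqSum q ≤ sqSum q + 2 - 2 * c * (max q.1 q.2 : ℕ))
    (fun q h => ?_) ?_ (fun k => ?_) (fun i => ?_) (fun i j hij => ?_) q
  · rw [stepMean_swap _ _ sqSum_swap, sqSum_swap, Prod.fst_swap, Prod.snd_swap, max_comm]
    exact h
  · rw [stepMean_diagonal _ _ sqSum_swap, departMean_succ_zero, departMean_zero_zero]
    norm_num [sqSum]
    nlinarith
  · rw [stepMean_diagonal _ _ sqSum_swap, departMean_succ_succ, departMean_succ_succ, max_self]
    generalize a * (1 - a) = p at *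
    simp only [sqSum]
    push_cast
    nlinarith [mul_nonneg (Nat.cast_nonneg (α := ℝ) k) (sub_nonneg.2 hc₂), mul_pos hlam₀ hp₀]
  · rw [stepMean_of_lt _ _ _ i.succ_pos, departMean_succ_succ, departMean_succ_zero,
      max_eq_left (Nat.zero_le _)]
    generalize a * (1 - a) = p at *
    simp only [sqSum]
    push_cast
    have hi : (0 : ℝ) ≤ i := Nat.cast_nonneg i
    have h1 : 0 ≤ (1 - lam) * (a - p) := mul_nonneg (by linarith) (by linarith)
    have h2 := mul_nonneg hi h1
    have h3 := mul_nonneg hi (sub_nonneg.2 hc₁)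
    nlinarith [mul_pos hlam₀ hp₀, mul_pos (sub_pos.2 hlam₁) ha₀]
  · rw [stepMean_of_lt _ _ _ (Nat.succ_lt_succ hij), departMean_succ_succ, departMean_succ_succ,
      max_eq_left (Nat.succ_le_succ hij.le)]
    generalize a * (1 - a) = p at *
    simp only [sqSum]
    push_cast
    have hi : (0 : ℝ) ≤ i := Nat.cast_nonneg i
    have hj : (0 : ℝ) ≤ j := Nat.cast_nonneg j
    have hij' : (j : ℝ) ≤ i := by exact_mod_cast hij.le
    -- The growth of the shorter queue is absorbed: if lam ≤ p the left side is nonpositive,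
    -- otherwise use j ≤ i and lam - p ≤ p - c.
    have h1 : (lam - p) * (j + 1) ≤ (p - c) * (i + 1) := by
      rcases le_total lam p with h | h
      · nlinarith
      · nlinarith
    nlinarith [mul_pos hlam₀ hp₀]

theorem exists_stepMean_sqSum_add_one_le {lam a : ℝ} (hlam₀ : 0 < lam) (hlam₁ : lam < 1)
    (ha₀ : 0 < a) (ha₁ : a < 1) (h : lam < 2 * (a * (1 - a))) :
    ∃ N : ℕ, ∀ q : ℕ × ℕ, q ∉ Set.Iic (N, N) → stepMean lam a sqSum q + 1 ≤ sqSum q := by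
  obtain ⟨c, hc₀, hc₁, hc₂⟩ : ∃ c, 0 < c ∧ c ≤ a * (1 - a) ∧ c ≤ 2 * (a * (1 - a)) - lam :=
    ⟨_, lt_min (mul_pos ha₀ (sub_pos.2 ha₁)) (sub_pos.2 h), min_le_left _ _, min_le_right _ _⟩
  -- Chosen so that 2 - 2cN ≤ -1.
  obtain ⟨N, hN⟩ := exists_nat_ge (3 / (2 * c))
  refine ⟨N, fun q hq => ?_⟩
  have h1 := stepMean_sqSum_le hlam₀ hlam₁ ha₀ ha₁ hc₁ hc₂ q
  have h2 : (N : ℝ) ≤ (max q.1 q.2 : ℕ) := by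
    have : N ≤ max q.1 q.2 := by
      simp only [Set.mem_Iic, Prod.le_def, not_and_or, not_le] at hq
      rcases hq with h | h
      · exact h.le.trans (le_max_left _ _)
      · exact h.le.trans (le_max_right _ _)
    exact_mod_cast this
  rw [div_le_iff₀ (by positivity)] at hN
  push_cast at h1 h2
  nlinarith

section

variable {lam a : I} (hlam₀ : 0 < lam) (hlam₁ : lam < 1) (ha₀ : 0 < a) (ha₁ : a < 1)

include hlam₀ hlam₁ ha₀ ha₁

theorem isErgodic_of_lt (h : (lam : ℝ) < 2 * (a * (1 - a))) : IsErgodic (step lam a) where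
  irreducible := isIrreducible_step hlam₀ hlam₁ ha₀ ha₁
  aperiodic := isAperiodic_step hlam₀ hlam₁ ha₀ ha₁
  positiveRecurrent := by
    obtain ⟨N, hN⟩ := exists_stepMean_sqSum_add_one_le (lam := lam) (a := a) hlam₀ hlam₁ ha₀ ha₁ h
    have h0 : ∀ q, 0 ≤ sqSum q := fun q => by unfold sqSum; positivity
    have h1 := fun q => (tsum_step_mul_ofReal lam a h0 q)
    refine isPositiveRecurrent_of_drift (isIrreducible_step hlam₀ hlam₁ ha₀ ha₁)
      (V := fun q => ENNReal.ofReal (sqSum q)) (Set.finite_Iic (N, N))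
      (fun q => by rw [h1]; exact ENNReal.ofReal_ne_top) (fun q hq => ?_)
    have h2 : 0 ≤ stepMean lam a sqSum q :=
      (hasMean_step lam a sqSum q).nonneg fun r => mul_nonneg ENNReal.toReal_nonneg (h0 r)
    rw [h1, ← ENNReal.ofReal_one, ← ENNReal.ofReal_add h2 zero_le_one]
    exact ENNReal.ofReal_le_ofReal (hN q hq)

end

/-! ### Instability at and above the threshold -/

/-- A function which is subharmonic outside a finite part of the diagonal if the load is at least
one. -/
noncomputable def potential (K : ℝ) (q : ℕ × ℕ) : ℝ :=
  (q.1 + q.2 : ℕ) + (9 / 10 : ℝ) ^ (q.1 + q.2) - K * (1 / 2) ^ min q.1 q.2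

theorem potential_swap (K : ℝ) (q : ℕ × ℕ) : potential K q.swap = potential K q := by
  simp [potential, add_comm, min_comm]

theorem potential_eq (K : ℝ) {i j s m : ℕ} (hs : i + j = s) (hm : min i j = m) :
    potential K (i, j) = s + (9 / 10 : ℝ) ^ s - K * (1 / 2) ^ m := by
  simp [potential, ← hs, ← hm]

/-- Each correction is harmless here. Convexity controls (9/10)^s, and (1/2)^min is superharmonic:
this amounts to 2p ≤ lam(1 + p) away from the diagonal and to 2p ≤ lam next to it. -/
theorem potential_le_stepMean_angle {lam a : ℝ} (hlam₁ : lam < 1) (ha₀ : 0 < a)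
    (ha₁ : a < 1) (h : 2 * (a * (1 - a)) ≤ lam) {K : ℝ} (hK : 0 ≤ K) {i j : ℕ} (hij : j < i) :
    potential K (i + 1, j + 1) ≤ stepMean lam a (potential K) (i + 1, j + 1) := by
  have hp₀ : 0 < a * (1 - a) := mul_pos ha₀ (sub_pos.2 ha₁)
  rw [stepMean_of_lt _ _ _ (Nat.succ_lt_succ hij), departMean_succ_succ, departMean_succ_succ]
  generalize a * (1 - a) = p at *
  have ht₀ : (0 : ℝ) ≤ (9 / 10) ^ (i + j + 1) := by positivity
  have ht₁ : (9 / 10 : ℝ) ^ (i + j + 1) ≤ 1 := pow_le_one₀ (by norm_num) (by norm_num)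
  have hu : 0 ≤ K * (1 / 2 : ℝ) ^ j := by positivity
  have h1 : 0 ≤ (lam - 2 * p) * (1 - 9 / 100 * (9 / 10) ^ (i + j + 1)) :=
    mul_nonneg (by linarith) (by linarith)
  have h2 : 0 ≤ p * (1 - lam) * (9 / 10) ^ (i + j + 1) := by
    have := sub_pos.2 hlam₁
    positivity
  have h3 : 0 ≤ K * (1 / 2 : ℝ) ^ j * (lam - 2 * p) := mul_nonneg hu (by linarith)
  have h4 : 0 ≤ K * (1 / 2 : ℝ) ^ j * (lam * p) := mul_nonneg hu (by nlinarith)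
  rw [potential_eq K (s := i + j + 1 + 1) (m := j + 1) (by omega) (by omega),
    potential_eq K (s := i + j + 1 + 1 + 1) (i := i + 1) (j := j + 1 + 1) (m := j + 1 + 1)
      (by omega) (by omega),
    potential_eq K (s := i + j + 1) (i := i + 1) (j := j) (m := j) (by omega) (by omega)]
  -- If i = j + 1, an arrival balances the queues, and then a departure from either relay lowers the
  -- minimum.
  obtain rfl | hij' : i = j + 1 ∨ j + 1 < i := by omega
  · rw [potential_eq K (s := j + 1 + j + 1 + 1) (m := j + 1) (by omega) (by omega),
      potential_eq K (s := j + 1 + j + 1) (m := j + 1) (by omega) (by omega)]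
    push_cast
    simp only [pow_succ _ j, pow_succ _ (j + 1), pow_succ _ (j + 1 + j + 1),
      pow_succ _ (j + 1 + j + 1 + 1)] at *
    nlinarith
  · rw [potential_eq K (s := i + j + 1 + 1) (m := j + 1 + 1) (by omega) (by omega),
      potential_eq K (s := i + j + 1) (m := j + 1) (by omega) (by omega)]
    push_cast
    simp only [pow_succ _ j, pow_succ _ (j + 1), pow_succ _ (i + j + 1),
      pow_succ _ (i + j + 1 + 1)] at *
    nlinarith

/-- An arrival joins the empty queue and stays there with probability at least 1 - 2p ≥ 1/2. The
K-term thus gains at least K·lam/4 = 1, which covers the loss of a packet in a slot without arrival.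
-/
theorem potential_le_stepMean_axis {lam a : ℝ} (hlam₀ : 0 < lam) (hlam₁ : lam < 1) (ha₀ : 0 < a)
    (ha₁ : a < 1) {K : ℝ} (hK : K * lam = 4) (i : ℕ) :
    potential K (i + 1, 0) ≤ stepMean lam a (potential K) (i + 1, 0) := by
  have hp₀ : 0 < a * (1 - a) := mul_pos ha₀ (sub_pos.2 ha₁)
  have hp₁ : a * (1 - a) ≤ 1 / 4 := by nlinarith [sq_nonneg (2 * a - 1)]
  rw [stepMean_of_lt _ _ _ i.succ_pos, departMean_succ_succ, departMean_succ_zero]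
  generalize a * (1 - a) = p at *
  have ht₀ : (0 : ℝ) ≤ (9 / 10) ^ i := by positivity
  have ht₁ : (9 / 10 : ℝ) ^ i ≤ 1 := pow_le_one₀ (by norm_num) (by norm_num)
  have h1 : 0 ≤ lam * (1 - 2 * p) * (1 - 9 / 100 * (9 / 10) ^ i) :=
    mul_nonneg (mul_nonneg hlam₀.le (by linarith)) (by linarith)
  have h2 : (1 - lam) * a * (1 - 1 / 10 * (9 / 10) ^ i) ≤ 1 :=
    mul_le_one₀ (mul_le_one₀ (by linarith) ha₀.le ha₁.le) (by linarith) (by linarith)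
  rw [potential_eq K (s := i + 1) (m := 0) (by omega) (by omega),
    potential_eq K (s := i + 1 + 1) (m := 1) (i := i + 1) (j := 0 + 1) (by omega) (by omega),
    potential_eq K (s := i) (m := 0) (i := i) (j := 0) (by omega) (by omega)]
  rcases i.eq_zero_or_pos with rfl | hi
  · rw [potential_eq K (s := 0 + 1) (m := 0) (by omega) (by omega)]
    push_cast
    norm_num at *
    nlinarith
  · rw [potential_eq K (s := i + 1) (m := 1) (by omega) (by omega)]
    push_cast
    simp only [pow_succ _ i, pow_succ _ (i + 1), pow_zero, pow_one] at *
    nlinarith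

/-- On the diagonal the minimum can only fall, which costs at most p·K(1/2)^k. The convexity of
(9/10)^s gains p times the right side of `hk`, since 9/500 = 2(1/10 - 9/100)(9/10). -/
theorem potential_le_stepMean_diagonal {lam a : ℝ} (hlam₁ : lam < 1) (ha₀ : 0 < a)
    (ha₁ : a < 1) (h : 2 * (a * (1 - a)) ≤ lam) {K : ℝ} {k : ℕ}
    (hk : K * (1 / 2) ^ k ≤ 9 / 500 * (1 - lam) * (81 / 100) ^ k) (hK : 0 ≤ K) :
    potential K (k + 1, k + 1) ≤ stepMean lam a (potential K) (k + 1, k + 1) := by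
  have hp₀ : 0 < a * (1 - a) := mul_pos ha₀ (sub_pos.2 ha₁)
  rw [stepMean_diagonal _ _ (potential_swap K), departMean_succ_succ, departMean_succ_succ]
  generalize a * (1 - a) = p at *
  have h0 : (81 / 100 : ℝ) ^ k = (9 / 10) ^ (2 * k) := by
    rw [pow_mul]
    norm_num
  rw [h0] at hk
  have ht₀ : (0 : ℝ) ≤ (9 / 10) ^ (2 * k) := by positivity
  have ht₁ : (9 / 10 : ℝ) ^ (2 * k) ≤ 1 := pow_le_one₀ (by norm_num) (by norm_num)
  have hu : 0 ≤ K * (1 / 2 : ℝ) ^ k := by positivity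
  have h1 : 0 ≤ (lam - 2 * p) * (1 - 81 / 1000 * (9 / 10) ^ (2 * k)) :=
    mul_nonneg (by linarith) (by linarith)
  have h2 := mul_le_mul_of_nonneg_left hk hp₀.le
  have h3 : 0 ≤ K * (1 / 2 : ℝ) ^ k * (lam * p) := mul_nonneg hu (by nlinarith)
  rw [potential_eq K (s := 2 * k + 1 + 1) (m := k + 1) (by omega) (by omega),
    potential_eq K (s := 2 * k + 1 + 1 + 1) (i := k + 1 + 1) (m := k + 1) (by omega) (by omega),
    potential_eq K (s := 2 * k + 1 + 1) (i := k + 1 + 1) (j := k) (m := k) (by omega) (by omega),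
    potential_eq K (s := 2 * k + 1) (i := k + 1) (j := k) (m := k) (by omega) (by omega),
    potential_eq K (s := 2 * k + 1) (i := k) (j := k + 1) (m := k) (by omega) (by omega)]
  push_cast
  simp only [pow_succ _ k, pow_succ _ (2 * k), pow_succ _ (2 * k + 1), pow_succ _ (2 * k + 1 + 1)] at *
  nlinarith

theorem exists_potential_le_stepMean {lam a : ℝ} (hlam₀ : 0 < lam) (hlam₁ : lam < 1) (ha₀ : 0 < a)
    (ha₁ : a < 1) (h : 2 * (a * (1 - a)) ≤ lam) {K : ℝ} (hK : K * lam = 4) :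
    ∃ m : ℕ, ∀ q : ℕ × ℕ, (∀ k ≤ m, q ≠ (k, k)) →
      potential K q ≤ stepMean lam a (potential K) q := by
  have hK₀ : 0 ≤ K := by nlinarith
  -- 50/81 is the ratio of 1/2 to (9/10)²: the cost on the diagonal decays faster than the gain.
  have hlim : Filter.Tendsto (fun k : ℕ => K * (50 / 81 : ℝ) ^ k) Filter.atTop (nhds (K * 0)) :=
    (tendsto_pow_atTop_nhds_zero_of_lt_one (by norm_num) (by norm_num)).const_mul K
  rw [mul_zero] at hlim
  have hlam : 0 < 9 / 500 * (1 - lam) := by linarith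
  obtain ⟨m, hm⟩ := Filter.eventually_atTop.1 (hlim.eventually_le_const hlam)
  refine ⟨m, symmetric_induction (fun q ih hq => ?_) (fun hq => ?_) (fun k hq => ?_)
    (fun i _ => ?_) (fun i j hij _ => ?_)⟩
  · rw [stepMean_swap _ _ (potential_swap K), potential_swap]
    refine ih fun k hk hqk => hq k hk ?_
    rw [hqk, Prod.swap_prod_mk]
  · exact absurd rfl (hq 0 m.zero_le)
  · refine potential_le_stepMean_diagonal hlam₁ ha₀ ha₁ h ?_ hK₀
    have hmk : m ≤ k := by
      by_contra hlt
      exact hq (k + 1) (by omega) rfl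
    have h1 := mul_le_mul_of_nonneg_right (hm k hmk) (show (0 : ℝ) ≤ (81 / 100) ^ k by positivity)
    rw [mul_assoc, ← mul_pow] at h1
    norm_num at h1 ⊢
    exact h1
  · exact potential_le_stepMean_axis hlam₀ hlam₁ ha₀ ha₁ hK i
  · exact potential_le_stepMean_angle hlam₁ ha₀ ha₁ h hK₀ hij

theorem sum_le_sum_depart (t₁ t₂ : Bool) (q : ℕ × ℕ) :
    q.1 + q.2 ≤ (depart t₁ t₂ q).1 + (depart t₁ t₂ q).2 + 1 := by
  unfold depart
  split_ifs <;> (try dsimp only) <;> omega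

theorem sum_join (tie : Bool) (q : ℕ × ℕ) : (join tie q).1 + (join tie q).2 = q.1 + q.2 + 1 := by
  unfold join
  split_ifs <;> (try dsimp only) <;> omega

theorem sum_le_of_step_ne_zero {lam a : I} {q r : ℕ × ℕ} (h : step lam a q r ≠ 0) :
    q.1 + q.2 ≤ r.1 + r.2 + 1 := by
  obtain ⟨t₁, t₂, rfl | ⟨tie, rfl⟩⟩ := mem_support_step h
  · exact sum_le_sum_depart t₁ t₂ q
  · have h1 := sum_le_sum_depart t₁ t₂ (join tie q)
    have h2 := sum_join tie q
    omega

/-- The total and the power of 9/10 lose at most 1 each, the last term at most `K`. -/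
theorem potential_le_add {K : ℝ} (hK : 0 ≤ K) {q r : ℕ × ℕ} (h : q.1 + q.2 ≤ r.1 + r.2 + 1) :
    potential K q ≤ potential K r + (2 + K) := by
  have h1 : ((q.1 + q.2 : ℕ) : ℝ) ≤ (r.1 + r.2 : ℕ) + 1 := by exact_mod_cast h
  have h2 : (9 / 10 : ℝ) ^ (q.1 + q.2) ≤ 1 := pow_le_one₀ (by norm_num) (by norm_num)
  have h3 : 0 ≤ (9 / 10 : ℝ) ^ (r.1 + r.2) := by positivity
  have h4 : 0 ≤ K * (1 / 2 : ℝ) ^ min q.1 q.2 := by positivity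
  have h5 : K * (1 / 2 : ℝ) ^ min r.1 r.2 ≤ K :=
    mul_le_of_le_one_right hK (pow_le_one₀ (by norm_num) (by norm_num))
  unfold potential
  linarith

section

variable {lam a : I} (hlam₀ : 0 < lam) (hlam₁ : lam < 1) (ha₀ : 0 < a) (ha₁ : a < 1)

include hlam₀ hlam₁ ha₀ ha₁

theorem not_isErgodic_of_le (h : 2 * (a * (1 - a)) ≤ (lam : ℝ)) : ¬ IsErgodic (step lam a) := by
  have hl : (0 : ℝ) < lam := hlam₀
  obtain ⟨K, hK⟩ : ∃ K : ℝ, K * lam = 4 := ⟨4 / lam, div_mul_cancel₀ _ hl.ne'⟩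
  have hK₀ : 0 ≤ K := by nlinarith
  obtain ⟨m, hm⟩ := exists_potential_le_stepMean (lam := lam) (a := a) hlam₀ hlam₁ ha₀ ha₁ h hK
  -- The potential at the exceptional states `(k, k)`, `k ≤ m`, is at most `2 * m + 1`; this `n`
  -- puts the level `M` at or above it.
  obtain ⟨n, hn⟩ := exists_nat_ge (2 * m + 1 + K)
  set M := potential K (n, n) with hM
  have hM' : 2 * m + 1 ≤ M := by
    have h1 : (0 : ℝ) ≤ (9 / 10) ^ (n + n) := by positivity
    have h2 : K * (1 / 2 : ℝ) ^ n ≤ K :=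
      mul_le_of_le_one_right hK₀ (pow_le_one₀ (by norm_num) (by norm_num))
    rw [hM, potential_eq K rfl (min_self n)]
    push_cast
    have : (0 : ℝ) ≤ n := n.cast_nonneg
    linarith
  have hsub : ∀ q, M < potential K q → potential K q ≤ stepMean lam a (potential K) q := by
    intro q hq
    refine hm q fun k hk hqk => hq.not_ge ?_
    have h1 : (9 / 10 : ℝ) ^ (k + k) ≤ 1 := pow_le_one₀ (by norm_num) (by norm_num)
    have h2 : 0 ≤ K * (1 / 2 : ℝ) ^ k := by positivity
    have h3 : (k : ℝ) ≤ m := by exact_mod_cast hk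
    rw [hqk, potential_eq K rfl (min_self k)]
    push_cast
    linarith
  -- Subharmonic everywhere: where it is positive the potential is subharmonic, and elsewhere it is
  -- 0.
  let φ : ℕ × ℕ → ℝ := fun q => max (potential K q - M) 0
  have hφ₀ : ∀ q, 0 ≤ φ q := fun q => le_max_right _ _
  intro hE
  refine not_isPositiveRecurrent_of_subharmonic (g := fun q => ENNReal.ofReal (φ q))
    (B := ENNReal.ofReal (2 + K)) (y := (n, n)) ENNReal.ofReal_ne_top ?_ (fun q r hqr => ?_)
    (fun q => ?_) ⟨(n + 1, n), ?_, ?_⟩ (hE.positiveRecurrent (n, n))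
  · simp [φ, hM]
  · rw [← ENNReal.ofReal_add (hφ₀ r) (by linarith)]
    refine ENNReal.ofReal_le_ofReal (max_le ?_ (by linarith [hφ₀ r]))
    have h1 := potential_le_add hK₀ (sum_le_of_step_ne_zero hqr)
    have h2 : potential K r - M ≤ φ r := le_max_left _ _
    linarith
  · rw [tsum_step_mul_ofReal lam a hφ₀]
    rcases le_or_gt (potential K q) M with h1 | h1
    · simp [φ, h1]
    · refine ENNReal.ofReal_le_ofReal ?_
      calc φ q = potential K q - M := max_eq_left (sub_nonneg.2 h1.le)
        _ ≤ stepMean lam a (potential K) q - M := by linarith [hsub q h1]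
        _ = stepMean lam a (fun r => potential K r - M) q := (stepMean_sub_const _ _ _ _ _).symm
        _ ≤ _ := stepMean_mono (fun r => le_max_left _ _) q
  · simpa [depart, join] using step_ne_zero hlam₀ hlam₁ ha₀ ha₁ true true false false (n, n)
  · have h1 : M < potential K (n + 1, n) := by
      have h2 : (9 / 10 : ℝ) ^ (n + n) ≤ 1 := pow_le_one₀ (by norm_num) (by norm_num)
      rw [hM, potential_eq K rfl (min_self n),
        potential_eq K (s := n + n + 1) (m := n) (by omega) (by omega), pow_succ]
      push_cast
      linarith
    simpa [φ] using h1

theorem isErgodic_iff : IsErgodic (step lam a) ↔ (lam : ℝ) < 2 * (a * (1 - a)) :=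
  ⟨fun hE => by
    by_contra hle
    exact not_isErgodic_of_le hlam₀ hlam₁ ha₀ ha₁ (not_lt.1 hle) hE,
    isErgodic_of_lt hlam₀ hlam₁ ha₀ ha₁⟩

end

/-- Since (1 - a)² + a² = 1 - 2p, the term 2p·lam cancels after clearing the denominator. -/
theorem load_lt_one_iff {lam a : ℝ} (hlam₁ : lam < 1) (ha₀ : 0 < a) (ha₁ : a < 1) :
    load lam a < 1 ↔ lam < 2 * (a * (1 - a)) := by
  have h1 := sub_pos.2 hlam₁
  have h2 := sub_pos.2 ha₁
  rw [load, div_lt_one (by positivity)]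
  constructor <;> intro h <;> nlinarith

end JSRQ

theorem theorem1 (lam a : unitInterval)
    (hlam₀ : 0 < lam) (hlam₁ : lam < 1) (ha₀ : 0 < a) (ha₁ : a < 1) :
    ∃ EH EV : ℝ × ℝ,
      -- `EH` and `EV` are the mean jump vectors in the angles `H` and `V`
      (∀ q ∈ JSRQ.angleH, JSRQ.meanJump lam a q = EH) ∧
      (∀ q ∈ JSRQ.angleV, JSRQ.meanJump lam a q = EV) ∧
      EH.1 + EH.2 = (lam : ℝ) - 2 * a * (1 - a) ∧
      EV.1 + EV.2 = (lam : ℝ) - 2 * a * (1 - a) ∧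
      (MarkovChain.IsErgodic (JSRQ.step lam a) ↔
        EH.1 < 0 ∧ EV.2 < 0 ∧ (lam : ℝ) - 2 * a * (1 - a) < 0) ∧
      (MarkovChain.IsErgodic (JSRQ.step lam a) ↔ JSRQ.load lam a < 1) := by
  refine ⟨_, _, fun q hq => JSRQ.meanJump_angleH lam a hq, fun q hq => JSRQ.meanJump_angleV lam a hq,
    by ring, by ring, ?_, ?_⟩
  · have hp : (0 : ℝ) < a * (1 - a) := mul_pos ha₀ (sub_pos.2 ha₁)
    rw [JSRQ.isErgodic_iff hlam₀ hlam₁ ha₀ ha₁, sub_neg, ← mul_assoc]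
    simp [hp]
  · rw [JSRQ.isErgodic_iff hlam₀ hlam₁ ha₀ ha₁, JSRQ.load_lt_one_iff hlam₁ ha₀ ha₁]
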